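/- **Theorem (selection rules).** Let $\hbar,\mu,c>0$ and $e\in\mathbb R$, let $\phi^{\rm ext}(\mathbf x)=\phi(|\mathbf x|)$ be a radial electrostatic potential with $\phi\in L^1_{\rm loc}((0,\infty);\mathbb R)$, and let $\mathbf A(\mathbf x)=\tfrac12\,\mathbf B\times\mathbf x$ be the vector potential of a uniform magnetic field $\mathbf B\in\mathbb R^3$. In spherical coordinates $x_1=r\sin\theta\cos\varphi$, $x_2=r\sin\theta\sin\varphi$, $x_3=r\cos\theta$ put $$F_l^m(\theta)=\sin^{|m|}\theta\;\frac{d^{\,l+|m|}}{dt^{\,l+|m|}}(t^2-1)^l\Big|_{t=\cos\theta},$$ so that $F_l^m(\theta)e^{im\varphi}$, for integers $l\ge0$ and $|m|\le l$, are the spherical harmonics up to normalization. Let $$\psi_k=R_{nl}(r)F_l^m(\theta)e^{im\varphi},\qquad \psi_{k'}=R_{n'l'}(r)F_{l'}^{m'}(\theta)e^{im'\varphi},\qquad |m|\le l,\ |m'|\le l',$$ with radial functions $R_{nl},R_{n'l'}\in C^1((0,\infty);\mathbb C)$, be nonzero stationary states of real energies $E_k,E_{k'}$, i.e. weak solutions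 on $\mathbb R^3\setminus\{0\}$ of the stationary Schrödinger equation $$\frac1{2\mu}\Big[-i\hbar\nabla-\frac ec\mathbf A\Big]^2\psi+e\phi(|\mathbf x|)\psi=E\psi ,$$ or, both of them, of the equation obtained from it by neglecting the term $\frac{e^2}{2\mu c^2}|\mathbf A|^2\psi$; assume that $\psi_k$, $\psi_{k'}$, $[-i\hbar\nabla-\frac ec\mathbf A]\psi_k$ and $[-i\hbar\nabla-\frac ec\mathbf A]\psi_{k'}$ are square integrable on $\mathbb R^3$. Define the radiation amplitude in the dipole approximation by $$\mathbf J_{kk'}=\int_{\mathbb R^3}\Big\{\Big(\big[-i\hbar\nabla-\tfrac ec\mathbf A\big]\psi_k\Big)\overline{\psi_{k'}}+\Big(\big[i\hbar\nabla-\tfrac ec\mathbf A\big]\overline{\psi_{k'}}\Big)\psi_k\Big\}\,d\mathbf y .$$ Then this integral converges absolutely, and $\mathbf J_{kk'}=0$ if either $l'\ne l\pm1$ or $m'\notin\{m,m+1,m-1\}$. -/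

import Mathlib

open MeasureTheory

noncomputable section

namespace DipoleRadiation

/-- Euclidean space `ℝ³`; the coordinates `x 0, x 1, x 2` are `x₁, x₂, x₃`. -/
abbrev Space : Type := EuclideanSpace ℝ (Fin 3)

/-- The polar angle `θ` of `x`: `x₃ = r cos θ`. -/
def polarAngle (x : Space) : ℝ := Real.arccos (x 2 / ‖x‖)

/-- The azimuthal angle `φ` of `x`: `x₁ = r sin θ cos φ`, `x₂ = r sin θ sin φ`. -/
def azimuth (x : Space) : ℝ := Complex.arg ⟨x 0, x 1⟩

/-- The real function `F_l^m(θ)`, the associated Legendre function of `cos θ`, up to normalization: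
`F_l^m(θ) = sin^{|m|} θ · (d/dt)^{l+|m|} (t² - 1)^l` at `t = cos θ`.
For `|m| ≤ l` the functions `F_l^m(θ) e^{imφ}` are, up to nonzero real factors, the
spherical harmonics `Y_l^m`. -/
def polarFactor (l : ℕ) (m : ℤ) (θ : ℝ) : ℝ :=
  Real.sin θ ^ m.natAbs *
    (Polynomial.derivative^[l + m.natAbs] ((Polynomial.X ^ 2 - 1 : Polynomial ℝ) ^ l)).eval
      (Real.cos θ)

/-- The wave function `R(r) F_l^m(θ) e^{imφ}`, as a function of the Cartesian coordinates. -/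
def separatedState (R : ℝ → ℂ) (l : ℕ) (m : ℤ) (x : Space) : ℂ :=
  R ‖x‖ * (polarFactor l m (polarAngle x) : ℂ) * Complex.exp (Complex.I * m * azimuth x)

/-- The vector potential `A(x) = B × x / 2` of a uniform magnetic field `B`. -/
def uniformVectorPotential (B x : Space) : Space :=
  WithLp.toLp 2 ((1 / 2 : ℝ) • crossProduct B.ofLp x.ofLp)

/-- The partial derivative `∂f/∂x_p`. -/
def partialDeriv (p : Fin 3) (f : Space → ℂ) (x : Space) : ℂ :=
  fderiv ℝ f x (EuclideanSpace.single p 1)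

/-- The vector field `[-iℏ∇ - (e/c) A] ψ`. -/
def kineticMomentum (hbar e c : ℝ) (A : Space → Space) (ψ : Space → ℂ) (x : Space) :
    EuclideanSpace ℂ (Fin 3) :=
  WithLp.toLp 2 fun p =>
    -Complex.I * hbar * partialDeriv p ψ x - (e / c : ℝ) * (A x p : ℝ) * ψ x

/-- `R(r) F_l^m(θ) e^{imφ}` is a stationary state of energy `E`, of finite kinetic energy, of an
electron in the radial electrostatic potential `φ(|x|)` and the uniform magnetic field `B`.

The eigenvalue equation is
`(1/2μ) [-iℏ∇ - (e/c) A]² ψ - (1 - κ) (e²/2μc²) |A|² ψ + e φ(|x|) ψ = E ψ`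
with `A = B × x / 2`, in the weak sense on `ℝ³ ∖ {0}`. For `κ = 1` it is the full magnetic
Schrödinger equation; for `κ = 0` it is the equation in which the term quadratic in the
magnetic field is neglected,
`-(ℏ²/2μ) Δψ + (iℏe/μc) A·∇ψ + e φ(|x|) ψ = E ψ`. -/
structure IsStationaryState (hbar μ e c κ : ℝ) (φ : ℝ → ℝ) (B : Space) (E : ℝ)
    (R : ℝ → ℂ) (l : ℕ) (m : ℤ) : Prop where
  contDiffOn : ContDiffOn ℝ 1 R (Set.Ioi 0)
  ne_zero : ∃ r : ℝ, 0 < r ∧ R r ≠ 0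
  memLp : MemLp (separatedState R l m) 2 volume
  kinetic_memLp :
    MemLp (kineticMomentum hbar e c (uniformVectorPotential B) (separatedState R l m)) 2 volume
  eigen : ∀ χ : Space → ℂ, ContDiff ℝ (⊤ : ℕ∞) χ → HasCompactSupport χ →
    (0 : Space) ∉ tsupport χ →
    (1 / (2 * μ) : ℝ) *
        (∫ x, ∑ p, kineticMomentum hbar e c (uniformVectorPotential B) (separatedState R l m) x p *
          starRingEnd ℂ (kineticMomentum hbar e c (uniformVectorPotential B) χ x p))
      - ((1 - κ) * e ^ 2 / (2 * μ * c ^ 2) : ℝ) *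
        (∫ x, ((‖uniformVectorPotential B x‖ ^ 2 : ℝ) : ℂ) *
          separatedState R l m x * starRingEnd ℂ (χ x))
      + (e : ℂ) * (∫ x, (φ ‖x‖ : ℂ) * separatedState R l m x * starRingEnd ℂ (χ x))
      = (E : ℂ) * ∫ x, separatedState R l m x * starRingEnd ℂ (χ x)

/-- The cross-current
`([-iℏ∇ - (e/c) A] ψ) ψ̄' + ([iℏ∇ - (e/c) A] ψ̄') ψ` of two wave functions. -/
def crossCurrent (hbar e c : ℝ) (A : Space → Space) (ψ ψ' : Space → ℂ) (x : Space) :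
    EuclideanSpace ℂ (Fin 3) :=
  WithLp.toLp 2 fun p =>
    (-Complex.I * hbar * partialDeriv p ψ x - (e / c : ℝ) * (A x p : ℝ) * ψ x) *
        starRingEnd ℂ (ψ' x)
      + (Complex.I * hbar * partialDeriv p (fun y => starRingEnd ℂ (ψ' y)) x
          - (e / c : ℝ) * (A x p : ℝ) * starRingEnd ℂ (ψ' x)) * ψ x

/-- The dipole approximation of the limiting radiation amplitude: the integral of the
cross-current over the whole space. -/
def dipoleAmplitude (hbar e c : ℝ) (A : Space → Space) (ψ ψ' : Space → ℂ) :
    EuclideanSpace ℂ (Fin 3) :=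
  ∫ x, crossCurrent hbar e c A ψ ψ' x

end DipoleRadiation

end

/-! Off the origin each state is a radial function times a solid harmonic: R(r) F_l^m e^{imφ} = R(r)
r^{-l} H(x), with H a harmonic homogeneous polynomial of degree l, and an eigenvector of x₁∂₂ - x₂∂₁
with eigenvalue im (`separatedState_eq`, `isSolidHarmonic_solidHarmonic`). The conjugate of ψ' has
the same form, with a solid harmonic K of degree l' and magnetic number -m'. Since A is linear in x,
each component of the cross-current restricted to a sphere about 0 is a combination, with constant
coefficients, of ∂_pH·K, H·∂_pK and x_q·HK. It suffices that these integrate to zero over spheres;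
polar coordinates do the rest.

For a homogeneous polynomial, the integral against γ = exp(-|x|²) is the integral over the unit
sphere times a nonzero radial factor, and Gaussian integrals can be treated algebraically through ∫
∂_pP γ = 2 ∫ x_pP γ. As ∂_pH is harmonic of degree l-1, orthogonality of harmonics of different
degrees kills ∂_pH·K unless l' = l-1, and likewise H·∂_pK unless l' = l+1. Under rotations about the
third axis ∂₃ preserves the magnetic number while ∂₁, ∂₂ mix and shift it by ±1; this kills both
products unless |m-m'| ≤ 1. Twice the Gaussian integral of x_p·HK is the sum of the other two, so it
vanishes with them.

Absolute convergence is the Cauchy–Schwarz inequality. -/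

open MeasureTheory MvPolynomial

noncomputable section

namespace DipoleRadiation

/-! ### Polynomials as functions on ℝ³ -/

/-- The value at a point of `ℝ³` of a complex polynomial in the Cartesian coordinates. -/
def polyFun (P : MvPolynomial (Fin 3) ℂ) (x : Space) : ℂ :=
  eval (fun i => ((x i : ℝ) : ℂ)) P

theorem polyFun_add (P Q : MvPolynomial (Fin 3) ℂ) (x : Space) :
    polyFun (P + Q) x = polyFun P x + polyFun Q x := by simp [polyFun]

theorem polyFun_mul (P Q : MvPolynomial (Fin 3) ℂ) (x : Space) :
    polyFun (P * Q) x = polyFun P x * polyFun Q x := by simp [polyFun]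

theorem polyFun_C (a : ℂ) (x : Space) : polyFun (C a) x = a := by simp [polyFun]

theorem polyFun_X (p : Fin 3) (x : Space) : polyFun (X p) x = (x p : ℂ) := by simp [polyFun]

theorem hasFDerivAt_polyFun (P : MvPolynomial (Fin 3) ℂ) (x : Space) :
    HasFDerivAt (polyFun P) (∑ p, polyFun (pderiv p P) x •
      (Complex.ofRealCLM.comp (EuclideanSpace.proj p : Space →L[ℝ] ℝ))) x := by
  induction P using MvPolynomial.induction_on with
  | C a =>
    have : polyFun (C a) = fun _ => a := funext (polyFun_C a)
    rw [this]
    exact (hasFDerivAt_const (𝕜 := ℝ) a x).congr_fderiv (by ext v; simp [polyFun])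
  | add P Q hP hQ =>
    have : polyFun (P + Q) = polyFun P + polyFun Q := funext (polyFun_add P Q)
    rw [this]
    refine (hP.add hQ).congr_fderiv ?_
    ext v
    simp [polyFun_add, add_mul, Finset.sum_add_distrib]
  | mul_X P q hP =>
    have : polyFun (P * X q) = polyFun P * polyFun (X q) := funext (polyFun_mul P (X q))
    rw [this]
    have hX : HasFDerivAt (polyFun (X q))
        (Complex.ofRealCLM.comp (EuclideanSpace.proj q : Space →L[ℝ] ℝ)) x := by
      have : polyFun (X q) = Complex.ofRealCLM.comp (EuclideanSpace.proj q : Space →L[ℝ] ℝ) := by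
        funext y; simp [polyFun_X]
      rw [this]
      exact ContinuousLinearMap.hasFDerivAt _
    refine (hP.mul hX).congr_fderiv ?_
    ext v
    simp only [pderiv_mul, polyFun_add, polyFun_mul, polyFun_X, pderiv_X, Pi.single_apply]
    fin_cases q <;> simp [Fin.sum_univ_three, polyFun] <;> ring

theorem differentiable_polyFun (P : MvPolynomial (Fin 3) ℂ) : Differentiable ℝ (polyFun P) :=
  fun x => (hasFDerivAt_polyFun P x).differentiableAt

theorem continuous_polyFun (P : MvPolynomial (Fin 3) ℂ) : Continuous (polyFun P) :=
  (differentiable_polyFun P).continuous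

theorem fderiv_polyFun_single (P : MvPolynomial (Fin 3) ℂ) (x : Space) (p : Fin 3) :
    fderiv ℝ (polyFun P) x (EuclideanSpace.single p 1) = polyFun (pderiv p P) x := by
  rw [(hasFDerivAt_polyFun P x).fderiv]
  fin_cases p <;> simp [Fin.sum_univ_three]

theorem polyFun_smul_of_isHomogeneous {P : MvPolynomial (Fin 3) ℂ} {d : ℕ}
    (hP : P.IsHomogeneous d) (r : ℝ) (x : Space) :
    polyFun P (r • x) = (r : ℂ) ^ d * polyFun P x := by
  simp only [polyFun, eval_eq', Finset.mul_sum]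
  refine Finset.sum_congr rfl fun k hk => ?_
  have hd : ∑ i, k i = d := by
    have := hP (mem_support_iff.1 hk)
    simpa [Finsupp.weight_apply, Finsupp.sum_fintype] using this
  rw [← hd]
  simp [Fin.prod_univ_three, Fin.sum_univ_three, mul_pow, pow_add]
  ring

/-! ### Gaussian integrals of polynomials -/

/-- The Gaussian weight `exp (-|x|²)`. -/
def gaussian (x : Space) : ℂ := (Real.exp (-‖x‖ ^ 2) : ℝ)

theorem hasFDerivAt_gaussian (x : Space) :
    HasFDerivAt gaussian (Complex.ofRealCLM.comp
      (Real.exp (-‖x‖ ^ 2) • -(2 • (innerSL ℝ x)))) x := by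
  have h := ((hasStrictFDerivAt_norm_sq x).hasFDerivAt.neg).exp
  exact Complex.ofRealCLM.hasFDerivAt.comp x h

theorem fderiv_gaussian_single (x : Space) (p : Fin 3) :
    fderiv ℝ gaussian x (EuclideanSpace.single p 1) = -2 * (x p : ℂ) * gaussian x := by
  rw [(hasFDerivAt_gaussian x).fderiv]
  simp [gaussian, EuclideanSpace.inner_single_right]
  ring

theorem integrable_norm_pow_mul_gaussian (d : ℕ) :
    Integrable (fun x : Space => ‖x‖ ^ d * Real.exp (-‖x‖ ^ 2)) := by
  refine (integrable_fun_norm_addHaar (E := Space) volume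
    (f := fun r : ℝ => r ^ d * Real.exp (-r ^ 2))).2 ?_
  -- The exponent d + 2 contains the Jacobian r² of polar coordinates in dimension 3.
  have h := (integrable_rpow_mul_exp_neg_mul_sq (b := 1) one_pos
    (s := ((d + 2 : ℕ) : ℝ)) (by linarith [Nat.cast_nonneg (α := ℝ) (d + 2)])).integrableOn
      (s := Set.Ioi (0 : ℝ))
  refine h.congr_fun (fun r _ => ?_) measurableSet_Ioi
  simp only [finrank_euclideanSpace, Fintype.card_fin, Real.rpow_natCast, smul_eq_mul]
  rw [pow_add, neg_one_mul]
  ring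

theorem integrable_polyFun_mul_gaussian (P : MvPolynomial (Fin 3) ℂ) :
    Integrable (fun x => polyFun P x * gaussian x) := by
  have hcg : Continuous gaussian := by unfold gaussian; fun_prop
  induction P using MvPolynomial.induction_on' with
  | monomial u a =>
    refine ((integrable_norm_pow_mul_gaussian (∑ i, u i)).const_mul ‖a‖).mono'
      ((continuous_polyFun _).mul hcg).aestronglyMeasurable (Filter.Eventually.of_forall fun x => ?_)
    have : ‖gaussian x‖ = Real.exp (-‖x‖ ^ 2) := by
      rw [gaussian, Complex.norm_real, Real.norm_of_nonneg (Real.exp_pos _).le]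
    rw [norm_mul, this, ← mul_assoc]
    refine mul_le_mul_of_nonneg_right ?_ (Real.exp_pos _).le
    rw [polyFun, eval_monomial, norm_mul, Finsupp.prod_fintype _ _ (by simp), norm_prod,
      ← Finset.prod_pow_eq_pow_sum]
    refine mul_le_mul_of_nonneg_left ?_ (norm_nonneg _)
    refine Finset.prod_le_prod (fun _ _ => norm_nonneg _) fun i _ => ?_
    rw [norm_pow, Complex.norm_real]
    exact pow_le_pow_left₀ (norm_nonneg _) (PiLp.norm_apply_le x i) _
  | add P Q hP hQ =>
    simp only [polyFun_add, add_mul]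
    exact hP.add hQ

/-- The Gaussian integral of a polynomial. -/
def gaussianIntegral (P : MvPolynomial (Fin 3) ℂ) : ℂ := ∫ x, polyFun P x * gaussian x

theorem gaussianIntegral_add (P Q : MvPolynomial (Fin 3) ℂ) :
    gaussianIntegral (P + Q) = gaussianIntegral P + gaussianIntegral Q := by
  simp only [gaussianIntegral, polyFun_add, add_mul]
  exact integral_add (integrable_polyFun_mul_gaussian P) (integrable_polyFun_mul_gaussian Q)

theorem gaussianIntegral_C_mul (a : ℂ) (P : MvPolynomial (Fin 3) ℂ) :
    gaussianIntegral (C a * P) = a * gaussianIntegral P := by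
  simp only [gaussianIntegral, polyFun_mul, polyFun_C, mul_assoc]
  exact integral_const_mul _ _

theorem gaussianIntegral_sub (P Q : MvPolynomial (Fin 3) ℂ) :
    gaussianIntegral (P - Q) = gaussianIntegral P - gaussianIntegral Q := by
  have := gaussianIntegral_add (P - Q) Q
  rw [sub_add_cancel] at this
  exact eq_sub_of_add_eq this.symm

theorem gaussianIntegral_sum (P : Fin 3 → MvPolynomial (Fin 3) ℂ) :
    gaussianIntegral (∑ p, P p) = ∑ p, gaussianIntegral (P p) := by
  simp only [Fin.sum_univ_three, gaussianIntegral_add]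

/-- Integration by parts against the Gaussian weight. -/
theorem gaussianIntegral_pderiv (p : Fin 3) (P : MvPolynomial (Fin 3) ℂ) :
    gaussianIntegral (pderiv p P) = 2 * gaussianIntegral (X p * P) := by
  have h1 : ∀ x, polyFun P x * fderiv ℝ gaussian x (EuclideanSpace.single p 1) =
      -2 * (polyFun (X p * P) x * gaussian x) := fun x => by
    rw [fderiv_gaussian_single, polyFun_mul, polyFun_X]; ring
  have := integral_mul_fderiv_eq_neg_fderiv_mul_of_integrable (μ := (volume : Measure Space))
    (f := polyFun P) (g := gaussian) (v := EuclideanSpace.single p 1)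
    (by simpa only [fderiv_polyFun_single] using integrable_polyFun_mul_gaussian (pderiv p P))
    (by simpa only [h1] using (integrable_polyFun_mul_gaussian (X p * P)).const_mul (-2))
    (integrable_polyFun_mul_gaussian P)
    (fun x _ => differentiable_polyFun P x)
    (fun x _ => (hasFDerivAt_gaussian x).differentiableAt)
  simp only [h1, fderiv_polyFun_single, integral_const_mul] at this
  simp only [gaussianIntegral]
  linear_combination this

/-! ### Laplacian, rotation generator and Euler's identity -/

theorem pderiv_pderiv_comm (p q : Fin 3) (P : MvPolynomial (Fin 3) ℂ) :
    pderiv p (pderiv q P) = pderiv q (pderiv p P) := by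
  induction P using MvPolynomial.induction_on with
  | C a => simp
  | add P Q hP hQ => simp [hP, hQ]
  | mul_X P i hP =>
    simp only [pderiv_mul, map_add, hP, pderiv_X, Pi.single_apply]
    split_ifs <;> simp [add_comm, add_left_comm]

/-- The Laplace operator on polynomials. -/
def laplacian (P : MvPolynomial (Fin 3) ℂ) : MvPolynomial (Fin 3) ℂ :=
  ∑ p, pderiv p (pderiv p P)

/-- The generator `x₁∂₂ - x₂∂₁` of the rotations about the third axis. -/
def rotation (P : MvPolynomial (Fin 3) ℂ) : MvPolynomial (Fin 3) ℂ :=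
  X 0 * pderiv 1 P - X 1 * pderiv 0 P

theorem laplacian_mul (P Q : MvPolynomial (Fin 3) ℂ) :
    laplacian (P * Q) =
      laplacian P * Q + 2 * ∑ p, pderiv p P * pderiv p Q + P * laplacian Q := by
  simp only [laplacian, pderiv_mul, map_add, Fin.sum_univ_three]
  ring

theorem laplacian_sum {ι : Type*} (s : Finset ι) (P : ι → MvPolynomial (Fin 3) ℂ) :
    laplacian (∑ i ∈ s, P i) = ∑ i ∈ s, laplacian (P i) := by
  simp only [laplacian, map_sum]
  exact Finset.sum_comm

theorem laplacian_C_mul (a : ℂ) (P : MvPolynomial (Fin 3) ℂ) :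
    laplacian (C a * P) = C a * laplacian P := by
  simp only [laplacian, pderiv_C_mul, Finset.mul_sum]

theorem laplacian_pderiv (p : Fin 3) (P : MvPolynomial (Fin 3) ℂ) :
    laplacian (pderiv p P) = pderiv p (laplacian P) := by
  simp only [laplacian, map_sum]
  exact Finset.sum_congr rfl fun q _ => by
    rw [pderiv_pderiv_comm q p P, pderiv_pderiv_comm q p (pderiv q P)]

theorem rotation_mul (P Q : MvPolynomial (Fin 3) ℂ) :
    rotation (P * Q) = rotation P * Q + P * rotation Q := by
  simp only [rotation, pderiv_mul]
  ring

theorem rotation_sum {ι : Type*} (s : Finset ι) (P : ι → MvPolynomial (Fin 3) ℂ) :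
    rotation (∑ i ∈ s, P i) = ∑ i ∈ s, rotation (P i) := by
  simp only [rotation, map_sum, Finset.mul_sum, Finset.sum_sub_distrib]

theorem rotation_C (a : ℂ) : rotation (C a) = 0 := by simp [rotation]

theorem rotation_pow_eq_zero {P : MvPolynomial (Fin 3) ℂ} (hP : rotation P = 0) (n : ℕ) :
    rotation (P ^ n) = 0 := by
  induction n with
  | zero => simp [rotation]
  | succ n ih => rw [pow_succ, rotation_mul, ih, hP]; simp

theorem rotation_pow_of_eigen {P : MvPolynomial (Fin 3) ℂ} {a : ℂ}
    (hP : rotation P = C a * P) (n : ℕ) : rotation (P ^ n) = C (n * a) * P ^ n := by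
  induction n with
  | zero => simp [rotation]
  | succ n ih =>
    rw [pow_succ, rotation_mul, ih, hP]
    simp only [Nat.cast_succ, map_mul, map_add, add_mul, one_mul]
    ring

/-- Differentiating Euler's identity lowers the degree by one. The degree is a complex number, so
degree 0 needs no truncated subtraction. -/
theorem euler_pderiv {P : MvPolynomial (Fin 3) ℂ} {a : ℂ}
    (hP : ∑ q, X q * pderiv q P = C a * P) (p : Fin 3) :
    ∑ q, X q * pderiv q (pderiv p P) = C (a - 1) * pderiv p P := by
  have h := congrArg (pderiv p) hP
  simp only [map_sum, pderiv_mul, pderiv_X, Pi.single_apply,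
    Finset.sum_add_distrib] at h
  simp only [eq_comm, ite_mul, one_mul, zero_mul, Finset.sum_ite_eq, Finset.mem_univ, if_true] at h
  simp only [pderiv_pderiv_comm _ p, map_sub, map_one]
  simp only [Fin.sum_univ_three, Fin.isValue] at h ⊢
  fin_cases p <;> simp at h ⊢ <;> linear_combination -h

/-! ### Orthogonality by degree and by magnetic number -/

/-- Green's identity: for harmonic f, ∇f·∇g = div(g∇f), and integration by parts against the
Gaussian turns the divergence into 2g (x·∇f) = 2a fg. The left side is symmetric in f and g. -/
theorem gaussianIntegral_sum_pderiv_mul_pderiv {f g : MvPolynomial (Fin 3) ℂ} {a : ℂ}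
    (hf : laplacian f = 0) (ef : ∑ p, X p * pderiv p f = C a * f) :
    gaussianIntegral (∑ p, pderiv p f * pderiv p g) = 2 * a * gaussianIntegral (f * g) := by
  have h1 : ∑ p, pderiv p f * pderiv p g = ∑ p, pderiv p (pderiv p f * g) := by
    have : ∑ p, pderiv p (pderiv p f * g) = laplacian f * g + ∑ p, pderiv p f * pderiv p g := by
      simp only [pderiv_mul, laplacian, Fin.sum_univ_three]; ring
    rw [this, hf, zero_mul, zero_add]
  have h2 : ∑ p, X p * (pderiv p f * g) = C a * (f * g) := by
    rw [← mul_assoc, ← ef, Finset.sum_mul]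
    exact Finset.sum_congr rfl fun p _ => by ring
  rw [h1, gaussianIntegral_sum]
  simp only [gaussianIntegral_pderiv, ← Finset.mul_sum]
  rw [← gaussianIntegral_sum, h2, gaussianIntegral_C_mul]
  ring

/-- Harmonic polynomials of different degrees are orthogonal. -/
theorem gaussianIntegral_mul_eq_zero_of_degree_ne {f g : MvPolynomial (Fin 3) ℂ} {a b : ℂ}
    (hf : laplacian f = 0) (hg : laplacian g = 0)
    (ef : ∑ p, X p * pderiv p f = C a * f) (eg : ∑ p, X p * pderiv p g = C b * g)
    (hab : a ≠ b) : gaussianIntegral (f * g) = 0 := by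
  have h1 := gaussianIntegral_sum_pderiv_mul_pderiv (g := g) hf ef
  have h2 := gaussianIntegral_sum_pderiv_mul_pderiv (g := f) hg eg
  simp only [mul_comm g f, mul_comm (pderiv _ g)] at h2
  have h3 : (a - b) * gaussianIntegral (f * g) = 0 := by linear_combination (h2 - h1) / 2
  exact (mul_eq_zero.1 h3).resolve_left (sub_ne_zero.2 hab)

/-- The rotation field is divergence-free and annihilates the Gaussian: the two integrations by
parts produce the same x₁x₂P. -/
theorem gaussianIntegral_rotation (P : MvPolynomial (Fin 3) ℂ) :
    gaussianIntegral (rotation P) = 0 := by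
  have h : rotation P = pderiv 1 (X 0 * P) - pderiv 0 (X 1 * P) := by
    simp [rotation, pderiv_X]
  rw [h, gaussianIntegral_sub, gaussianIntegral_pderiv, gaussianIntegral_pderiv,
    mul_left_comm (X 1), sub_self]

theorem gaussianIntegral_mul_eq_zero_of_rotation {f g : MvPolynomial (Fin 3) ℂ} {a b : ℂ}
    (hf : rotation f = C a * f) (hg : rotation g = C b * g) (hab : a + b ≠ 0) :
    gaussianIntegral (f * g) = 0 := by
  have h := gaussianIntegral_rotation (f * g)
  rw [rotation_mul, hf, hg, mul_left_comm f, mul_assoc, ← add_mul, ← map_add,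
    gaussianIntegral_C_mul] at h
  exact (mul_eq_zero.1 h).resolve_left hab

/-- The horizontal components of a vector operator shift the rotation eigenvalue by `± i`. -/
theorem gaussianIntegral_mul_eq_zero_of_rotation_pair {f₀ f₁ g : MvPolynomial (Fin 3) ℂ} {a b : ℂ}
    (h₀ : rotation f₀ = C a * f₀ - f₁) (h₁ : rotation f₁ = C a * f₁ + f₀)
    (hg : rotation g = C b * g) (hab : (a + b) ^ 2 ≠ -1) :
    gaussianIntegral (f₀ * g) = 0 ∧ gaussianIntegral (f₁ * g) = 0 := by
  have e₀ : (a + b) * gaussianIntegral (f₀ * g) - gaussianIntegral (f₁ * g) = 0 := by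
    rw [← gaussianIntegral_C_mul, ← gaussianIntegral_sub, ← gaussianIntegral_rotation (f₀ * g),
      rotation_mul, h₀, hg, map_add]
    congr 1; ring
  have e₁ : (a + b) * gaussianIntegral (f₁ * g) + gaussianIntegral (f₀ * g) = 0 := by
    rw [← gaussianIntegral_C_mul, ← gaussianIntegral_add, ← gaussianIntegral_rotation (f₁ * g),
      rotation_mul, h₁, hg, map_add]
    congr 1; ring
  -- `e₀` and `e₁` form a linear system in the two integrals, with determinant (a + b)² + 1.
  have hne : (a + b) ^ 2 + 1 ≠ 0 := fun h => hab (eq_neg_of_add_eq_zero_left h)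
  constructor
  · refine (mul_eq_zero.1 (?_ : ((a + b) ^ 2 + 1) * _ = 0)).resolve_left hne
    linear_combination (a + b) * e₀ + e₁
  · refine (mul_eq_zero.1 (?_ : ((a + b) ^ 2 + 1) * _ = 0)).resolve_left hne
    linear_combination (a + b) * e₁ - e₀

/-! ### Selection rules for solid harmonics -/

/-- `H` is a solid harmonic of degree `l` and magnetic number `m`: a harmonic homogeneous
polynomial of degree `l` on which the rotations about the third axis act by `e^{imα}`. -/
structure IsSolidHarmonic (l : ℕ) (m : ℤ) (H : MvPolynomial (Fin 3) ℂ) : Prop where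
  isHomogeneous : H.IsHomogeneous l
  laplacian_eq_zero : laplacian H = 0
  rotation_eq : rotation H = C (Complex.I * m) * H

namespace IsSolidHarmonic

variable {l l' : ℕ} {m m' : ℤ} {H K : MvPolynomial (Fin 3) ℂ}

theorem euler (hH : IsSolidHarmonic l m H) :
    ∑ p, X p * pderiv p H = C (l : ℂ) * H := by
  rw [hH.isHomogeneous.sum_X_mul_pderiv, nsmul_eq_mul, map_natCast]

theorem gaussianIntegral_pderiv_mul_of_degree (hH : IsSolidHarmonic l m H)
    (hK : IsSolidHarmonic l' m' K) (hl : (l' : ℤ) ≠ l - 1) (p : Fin 3) :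
    gaussianIntegral (pderiv p H * K) = 0 := by
  refine gaussianIntegral_mul_eq_zero_of_degree_ne
    (by rw [laplacian_pderiv, hH.laplacian_eq_zero, map_zero]) hK.laplacian_eq_zero
    (euler_pderiv hH.euler p) hK.euler fun h => hl ?_
  exact_mod_cast h.symm

theorem gaussianIntegral_pderiv_mul_of_magnetic (hH : IsSolidHarmonic l m H)
    (hK : IsSolidHarmonic l' m' K) (h0 : m + m' ≠ 0) (h1 : m + m' ≠ 1) (h2 : m + m' ≠ -1)
    (p : Fin 3) : gaussianIntegral (pderiv p H * K) = 0 := by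
  have hr (q : Fin 3) : pderiv q (X 0 * pderiv 1 H - X 1 * pderiv 0 H) =
      C (Complex.I * m) * pderiv q H := by
    rw [← pderiv_C_mul, ← hH.rotation_eq, rotation]
  -- The commutators of the rotation generator with the partial derivatives: the gradient is a
  -- vector operator.
  have r0 : rotation (pderiv 0 H) = C (Complex.I * m) * pderiv 0 H - pderiv 1 H := by
    rw [← hr]
    simp [rotation, pderiv_X, pderiv_pderiv_comm 1 0]
    ring
  have r1 : rotation (pderiv 1 H) = C (Complex.I * m) * pderiv 1 H + pderiv 0 H := by
    rw [← hr]
    simp [rotation, pderiv_X, pderiv_pderiv_comm 1 0]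
    ring
  have r2 : rotation (pderiv 2 H) = C (Complex.I * m) * pderiv 2 H := by
    rw [← hr]
    simp [rotation, pderiv_X, pderiv_pderiv_comm _ 2]
  have hsq : (Complex.I * m + Complex.I * m') ^ 2 ≠ -1 := by
    rw [← mul_add, mul_pow, Complex.I_sq]
    intro h
    have h' : (m + m') ^ 2 = 1 := by
      have : ((m : ℂ) + m') ^ 2 = 1 := by linear_combination -h
      exact_mod_cast this
    rcases sq_eq_sq_iff_eq_or_eq_neg.1 (h'.trans (one_pow 2).symm) with h | h <;> contradiction
  have hpair := gaussianIntegral_mul_eq_zero_of_rotation_pair r0 r1 hK.rotation_eq hsq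
  have hz : gaussianIntegral (pderiv 2 H * K) = 0 := by
    refine gaussianIntegral_mul_eq_zero_of_rotation r2 hK.rotation_eq fun h => h0 ?_
    rw [← mul_add] at h
    exact_mod_cast (mul_eq_zero.1 h).resolve_left Complex.I_ne_zero
  fin_cases p
  exacts [hpair.1, hpair.2, hz]

end IsSolidHarmonic

/-! ### The explicit solid harmonics -/

/-- The polynomial `x₁² + x₂² + x₃²`. -/
def normSqPoly : MvPolynomial (Fin 3) ℂ := ∑ p, X p ^ 2

/-- The linear form `x₁ + i x₂` for `m ≥ 0`, and `x₁ - i x₂` for `m < 0`. -/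
def azimuthalForm (m : ℤ) : MvPolynomial (Fin 3) ℂ :=
  X 0 + C (if 0 ≤ m then Complex.I else -Complex.I) * X 1

/-- The coefficient of `t^(l-M-2j)` in `(d/dt)^(l+M) (t²-1)^l`. -/
def legendreCoeff (l M j : ℕ) : ℤ :=
  (-1) ^ j * (l.choose j * (2 * (l - j)).descFactorial (l + M) : ℕ)

/-- The homogeneous polynomial whose restriction to the unit sphere is `F_l^m(θ) e^{imφ}`. -/
def solidHarmonic (l : ℕ) (m : ℤ) : MvPolynomial (Fin 3) ℂ :=
  ∑ j ∈ Finset.range (l + 1), C (legendreCoeff l m.natAbs j : ℂ) *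
    (normSqPoly ^ j * (azimuthalForm m ^ m.natAbs * X 2 ^ (l - m.natAbs - 2 * j)))

theorem isHomogeneous_normSqPoly : normSqPoly.IsHomogeneous 2 :=
  IsHomogeneous.sum _ _ _ fun p _ => isHomogeneous_X_pow p 2

theorem isHomogeneous_azimuthalForm (m : ℤ) : (azimuthalForm m).IsHomogeneous 1 :=
  (isHomogeneous_X _ _).add ((isHomogeneous_X _ _).C_mul _)

theorem pderiv_normSqPoly (p : Fin 3) : pderiv p normSqPoly = 2 * X p := by
  fin_cases p <;> simp [normSqPoly, Fin.sum_univ_three, pderiv_X]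

theorem laplacian_normSqPoly_pow (j : ℕ) :
    laplacian (normSqPoly ^ j) = (j * (4 * j + 2) : ℕ) * normSqPoly ^ (j - 1) := by
  have h2 (p : Fin 3) : pderiv p (2 : MvPolynomial (Fin 3) ℂ) = 0 :=
    (pderiv p).map_natCast 2
  have hs : X 0 ^ 2 + X 1 ^ 2 + X 2 ^ 2 = normSqPoly := by simp [normSqPoly, Fin.sum_univ_three]
  rcases j with _ | _ | j
  · simp [laplacian]
  · simp [laplacian, pderiv_normSqPoly, h2]
    norm_num
  · simp only [laplacian, pderiv_pow, pderiv_mul, pderiv_normSqPoly, Fin.sum_univ_three,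
      Nat.add_sub_cancel, Derivation.map_natCast, pderiv_X_self, h2]
    push_cast
    linear_combination (4 * (j + 2) * (j + 1) * normSqPoly ^ j) * hs

/-- The gradient (1, ±i, 0) of the linear form is isotropic: 1 + (±i)² = 0. -/
theorem laplacian_azimuthalForm_pow (m : ℤ) (M : ℕ) : laplacian (azimuthalForm m ^ M) = 0 := by
  set a : ℂ := if 0 ≤ m then Complex.I else -Complex.I with ha
  have hsq : a * a = -1 := by rw [ha]; split_ifs <;> simp
  have h0 : pderiv 0 (azimuthalForm m) = 1 := by simp [azimuthalForm, pderiv_X]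
  have h1 : pderiv 1 (azimuthalForm m) = C a := by simp [azimuthalForm, pderiv_X, ← ha]
  have h2 : pderiv 2 (azimuthalForm m) = 0 := by simp [azimuthalForm, pderiv_X]
  have hC : (C a * C a : MvPolynomial (Fin 3) ℂ) = -1 := by rw [← C_mul, hsq]; simp
  simp only [laplacian, pderiv_pow, pderiv_mul, h0, h1, h2, Fin.sum_univ_three, pderiv_C,
    pderiv_one, Derivation.map_natCast, mul_zero, map_zero]
  linear_combination ((M : MvPolynomial (Fin 3) ℂ) * (M - 1 : ℕ) *
    azimuthalForm m ^ (M - 1 - 1)) * hC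

theorem laplacian_azimuthalForm_pow_mul (m : ℤ) (M k : ℕ) :
    laplacian (azimuthalForm m ^ M * X 2 ^ k) =
      ((k * (k - 1) : ℕ) : MvPolynomial (Fin 3) ℂ) * (azimuthalForm m ^ M * X 2 ^ (k - 2)) := by
  rw [laplacian_mul, laplacian_azimuthalForm_pow]
  have h2 : pderiv 2 (azimuthalForm m) = 0 := by simp [azimuthalForm, pderiv_X]
  simp only [laplacian, pderiv_pow, pderiv_mul, h2, Fin.sum_univ_three, pderiv_X_self,
    Derivation.map_natCast, pderiv_X_of_ne (show (2 : Fin 3) ≠ 0 by decide),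
    pderiv_X_of_ne (show (2 : Fin 3) ≠ 1 by decide), map_zero, mul_zero, pderiv_one, Nat.sub_sub]
  push_cast
  ring

/-- The cross term 2∇|x|^{2j}·∇f equals 4jd |x|^{2j-2} f by Euler's identity. At j = 0 the
coefficient vanishes, so the truncated exponent is harmless. -/
theorem laplacian_normSqPoly_pow_mul {f : MvPolynomial (Fin 3) ℂ} {d : ℕ}
    (hf : f.IsHomogeneous d) (j : ℕ) :
    laplacian (normSqPoly ^ j * f) =
      (j * (4 * d + 4 * j + 2) : ℕ) * (normSqPoly ^ (j - 1) * f) +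
        normSqPoly ^ j * laplacian f := by
  have he := hf.sum_X_mul_pderiv
  rw [nsmul_eq_mul] at he
  have : ∑ p, pderiv p (normSqPoly ^ j) * pderiv p f =
      2 * j * normSqPoly ^ (j - 1) * (d * f) := by
    rw [← he, Finset.mul_sum]
    exact Finset.sum_congr rfl fun p _ => by rw [pderiv_pow, pderiv_normSqPoly]; ring
  rw [laplacian_mul, laplacian_normSqPoly_pow, this]
  push_cast
  ring

/-- The terms whose exponent l - M - 2j would be negative, and is truncated to 0, carry coefficient
zero. -/
theorem legendreCoeff_eq_zero {l M j : ℕ} (h : l < M + 2 * j) : legendreCoeff l M j = 0 := by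
  rcases le_or_gt j l with hj | hj
  · rw [legendreCoeff, Nat.descFactorial_of_lt (by omega)]
    simp
  · rw [legendreCoeff, Nat.choose_eq_zero_of_lt hj]
    simp

/-- The recursion that makes the solid harmonic harmonic: contributions of neighbouring terms to the
same monomial cancel. It follows from the ratios of consecutive binomials and falling factorials. -/
theorem legendreCoeff_succ {l M j : ℕ} (hM : M ≤ l) (hj : j < l) :
    legendreCoeff l M j * ((l - M - 2 * j) * (l - M - 2 * j - 1) : ℕ) +
      legendreCoeff l M (j + 1) *
        ((j + 1) * (4 * (M + (l - M - 2 * (j + 1))) + 4 * (j + 1) + 2) : ℕ) = 0 := by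
  rcases lt_or_ge l (M + 2 * (j + 1)) with h | h
  · rw [legendreCoeff_eq_zero h]
    have : l - M - 2 * j = 0 ∨ l - M - 2 * j = 1 := by omega
    rcases this with h | h <;> simp [h]
  · obtain ⟨i, rfl⟩ : ∃ i, l = j + 1 + i := ⟨l - (j + 1), by omega⟩
    obtain ⟨k, hk⟩ : ∃ k, j + 1 + i - M - 2 * j = k + 2 :=
      ⟨j + 1 + i - M - 2 * j - 2, by omega⟩
    have hk' : j + 1 + i - M - 2 * (j + 1) = k := by omega
    have e1 := Nat.choose_succ_right_eq (j + 1 + i) j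
    have e2 := Nat.succ_descFactorial (2 * i + 1) (j + 1 + i + M)
    have e3 := Nat.succ_descFactorial (2 * i) (j + 1 + i + M)
    have s1 : j + 1 + i - j = i + 1 := by omega
    have s2 : 2 * i + 1 + 1 - (j + 1 + i + M) = k + 2 := by omega
    have s3 : 2 * i + 1 - (j + 1 + i + M) = k + 1 := by omega
    have s4 : j + 1 + i - (j + 1) = i := by omega
    rw [s1] at e1
    rw [s2] at e2
    rw [s3] at e3
    obtain ⟨t, rfl⟩ : ∃ t, i = j + 1 + t := ⟨i - (j + 1), by omega⟩
    have hkM : M + k = t := by omega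
    simp only [legendreCoeff, s1, s4, hk, hk', hkM]
    rw [show 2 * (j + 1 + t + 1) = 2 * (j + 1 + t) + 1 + 1 by ring,
      show k + 2 - 1 = k + 1 by omega]
    generalize (j + 1 + (j + 1 + t)).choose j = c₀ at *
    generalize (j + 1 + (j + 1 + t)).choose (j + 1) = c₁ at *
    generalize (2 * (j + 1 + t) + 1 + 1).descFactorial (j + 1 + (j + 1 + t) + M) = d₀ at *
    generalize (2 * (j + 1 + t) + 1).descFactorial (j + 1 + (j + 1 + t) + M) = d₁ at *
    generalize (2 * (j + 1 + t)).descFactorial (j + 1 + (j + 1 + t) + M) = d₂ at *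
    zify at e1 e2 e3
    push_cast
    linear_combination (-1) ^ j * (c₀ * (k + 1) * e2 + c₀ * (2 * (j + 1 + t) + 2) * e3
      - 2 * (2 * (j + 1 + t) + 1) * d₂ * e1)

theorem laplacian_solidHarmonic {l : ℕ} {m : ℤ} (hm : m.natAbs ≤ l) :
    laplacian (solidHarmonic l m) = 0 := by
  set M := m.natAbs with hMdef
  have key (j : ℕ) : laplacian (C (legendreCoeff l M j : ℂ) *
      (normSqPoly ^ j * (azimuthalForm m ^ M * X 2 ^ (l - M - 2 * j)))) =
      ((legendreCoeff l M j * (j * (4 * (M + (l - M - 2 * j)) + 4 * j + 2) : ℕ) : ℤ) :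
        MvPolynomial (Fin 3) ℂ) *
        (normSqPoly ^ (j - 1) * (azimuthalForm m ^ M * X 2 ^ (l - M - 2 * j))) +
      ((legendreCoeff l M j * ((l - M - 2 * j) * (l - M - 2 * j - 1) : ℕ) : ℤ) :
        MvPolynomial (Fin 3) ℂ) *
        (normSqPoly ^ j * (azimuthalForm m ^ M * X 2 ^ (l - M - 2 * (j + 1)))) := by
    have hhom : (azimuthalForm m ^ M * X 2 ^ (l - M - 2 * j)).IsHomogeneous
        (M + (l - M - 2 * j)) := by
      simpa using ((isHomogeneous_azimuthalForm m).pow M).mul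
        (isHomogeneous_X_pow (R := ℂ) (2 : Fin 3) (l - M - 2 * j))
    rw [laplacian_C_mul, laplacian_normSqPoly_pow_mul hhom, laplacian_azimuthalForm_pow_mul,
      map_intCast, show l - M - 2 * (j + 1) = l - M - 2 * j - 2 by omega]
    push_cast
    ring
  -- Shifting the index of the first sum aligns it with the second. The dropped terms vanish: j = 0
  -- has the factor j, and j = l has exponent l - M - 2l = 0.
  rw [solidHarmonic, laplacian_sum, Finset.sum_congr rfl fun j _ => key j, Finset.sum_add_distrib,
    Finset.sum_range_succ', Finset.sum_range_succ _ l]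
  have hl : (l - M - 2 * l) = 0 := by omega
  rw [hl]
  simp only [zero_mul, Nat.cast_zero, mul_zero, Int.cast_zero, add_zero]
  rw [← Finset.sum_add_distrib]
  refine Finset.sum_eq_zero fun j hj => ?_
  rw [Nat.add_sub_cancel, ← add_mul, ← Int.cast_add, add_comm,
    legendreCoeff_succ hm (Finset.mem_range.1 hj)]
  simp

theorem rotation_azimuthalForm (m : ℤ) :
    rotation (azimuthalForm m) =
      C (if 0 ≤ m then Complex.I else -Complex.I) * azimuthalForm m := by
  set a : ℂ := if 0 ≤ m then Complex.I else -Complex.I with ha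
  have hsq : a * a = -1 := by rw [ha]; split_ifs <;> simp
  have hC : (C a * C a : MvPolynomial (Fin 3) ℂ) = -1 := by rw [← C_mul, hsq]; simp
  have h0 : pderiv 0 (azimuthalForm m) = 1 := by simp [azimuthalForm, pderiv_X]
  have h1 : pderiv 1 (azimuthalForm m) = C a := by simp [azimuthalForm, pderiv_X, ← ha]
  rw [rotation, h0, h1, azimuthalForm, ← ha]
  linear_combination -X 1 * hC

theorem isSolidHarmonic_solidHarmonic {l : ℕ} {m : ℤ} (hm : m.natAbs ≤ l) :
    IsSolidHarmonic l m (solidHarmonic l m) where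
  isHomogeneous := by
    refine IsHomogeneous.sum _ _ _ fun j _ => ?_
    rcases lt_or_ge l (m.natAbs + 2 * j) with h | h
    · rw [legendreCoeff_eq_zero h]
      simpa using isHomogeneous_zero (Fin 3) ℂ l
    · have := (isHomogeneous_normSqPoly.pow j).mul (((isHomogeneous_azimuthalForm m).pow
        m.natAbs).mul (isHomogeneous_X_pow (R := ℂ) (2 : Fin 3) (l - m.natAbs - 2 * j)))
      rw [show 2 * j + (1 * m.natAbs + (l - m.natAbs - 2 * j)) = l by omega] at this
      exact this.C_mul _
  laplacian_eq_zero := laplacian_solidHarmonic hm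
  rotation_eq := by
    have hX : rotation (X 2) = 0 := by simp [rotation, pderiv_X]
    have hs : rotation normSqPoly = 0 := by
      rw [rotation, pderiv_normSqPoly, pderiv_normSqPoly]; ring
    have hm' : (m.natAbs : ℂ) * (if 0 ≤ m then Complex.I else -Complex.I) = Complex.I * m := by
      have hc : ((m.natAbs : ℤ) : ℂ) = (m.natAbs : ℂ) := by simp
      rw [← hc]
      split_ifs with h
      · rw [Int.natAbs_of_nonneg h, mul_comm]
      · rw [Int.ofNat_natAbs_of_nonpos (by omega)]; push_cast; ring
    rw [solidHarmonic, rotation_sum, Finset.mul_sum]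
    refine Finset.sum_congr rfl fun j _ => ?_
    rw [rotation_mul, rotation_C, rotation_mul, rotation_pow_eq_zero hs, rotation_mul,
      rotation_pow_eq_zero hX, rotation_pow_of_eigen (rotation_azimuthalForm m), hm']
    ring

/-! ### From Gaussian integrals to integrals over spheres -/

/-- The surface measure of the unit sphere of `ℝ³`. -/
abbrev sphereMeasure : Measure (Metric.sphere (0 : Space) 1) := (volume : Measure Space).toSphere

theorem integral_eq_integral_sphere_prod (f : Space → ℂ) :
    ∫ x, f x = ∫ z, f (z.2.1 • z.1.1) ∂(sphereMeasure.prod (Measure.volumeIoiPow 2)) := by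
  have h := (volume : Measure Space).measurePreserving_homeomorphUnitSphereProd.integral_comp
    (Homeomorph.measurableEmbedding _) (fun z => f (z.2.1 • z.1.1))
  rw [finrank_euclideanSpace, Fintype.card_fin] at h
  have h₀ : ∫ x, f x = ∫ x : ({0}ᶜ : Set Space), f x.1 ∂(volume.comap Subtype.val) := by
    rw [integral_subtype_comap (measurableSet_singleton _).compl f, restrict_compl_singleton]
  rw [← h, h₀]
  refine integral_congr_ae (Filter.Eventually.of_forall fun x => ?_)
  have hx : ‖(x : Space)‖ ≠ 0 := norm_ne_zero_iff.2 x.2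
  simp [smul_smul, hx]

theorem integral_eq_zero_of_integral_sphere_eq_zero {f : Space → ℂ}
    (h : ∀ r : ℝ, 0 < r → ∫ ω, f (r • ω.1) ∂sphereMeasure = 0) : ∫ x, f x = 0 := by
  rw [integral_eq_integral_sphere_prod]
  by_cases hf : Integrable (fun z : Metric.sphere (0 : Space) 1 × Set.Ioi (0 : ℝ) =>
      f (z.2.1 • z.1.1)) (sphereMeasure.prod (Measure.volumeIoiPow 2))
  · rw [integral_prod_symm _ hf]
    exact integral_eq_zero_of_ae (Filter.Eventually.of_forall fun r => h r.1 r.2)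
  -- Without integrability the Bochner integral is 0 by convention, so no integrability hypothesis
  -- is needed.
  · exact integral_undef hf

/-- If it vanished, so would the integral over space of |x|^d exp(-|x|²), which is positive. This
permits division by the radial factor. -/
theorem integral_radial_gaussian_ne_zero (d : ℕ) :
    ∫ r : Set.Ioi (0 : ℝ), (r.1 : ℂ) ^ d * (Real.exp (-r.1 ^ 2) : ℝ)
      ∂(Measure.volumeIoiPow 2) ≠ 0 := by
  intro h0
  have hpos : 0 < ∫ x : Space, ‖x‖ ^ d * Real.exp (-‖x‖ ^ 2) := by
    rw [integral_pos_iff_support_of_nonneg (fun x => by positivity)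
      (integrable_norm_pow_mul_gaussian d)]
    have hsub : ({0}ᶜ : Set Space) ⊆
        Function.support fun x : Space => ‖x‖ ^ d * Real.exp (-‖x‖ ^ 2) := fun x hx =>
      mul_ne_zero (pow_ne_zero _ (norm_ne_zero_iff.2 hx)) (Real.exp_pos _).ne'
    refine lt_of_lt_of_le ?_ (measure_mono hsub)
    exact isOpen_compl_singleton.measure_pos _ ⟨EuclideanSpace.single 0 1, by simp⟩
  have h1 : ((∫ x : Space, ‖x‖ ^ d * Real.exp (-‖x‖ ^ 2) : ℝ) : ℂ) = 0 := by
    rw [← integral_complex_ofReal, integral_eq_integral_sphere_prod]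
    have hz (z : Metric.sphere (0 : Space) 1 × Set.Ioi (0 : ℝ)) :
        ((‖z.2.1 • z.1.1‖ ^ d * Real.exp (-‖z.2.1 • z.1.1‖ ^ 2) : ℝ) : ℂ) =
          1 * ((z.2.1 : ℂ) ^ d * (Real.exp (-z.2.1 ^ 2) : ℝ)) := by
      have hr : ‖z.2.1 • z.1.1‖ = z.2.1 := by
        rw [norm_smul, norm_eq_of_mem_sphere, mul_one, Real.norm_of_nonneg (le_of_lt z.2.2)]
      rw [hr]
      push_cast
      ring
    simp_rw [hz]
    rw [integral_prod_mul (fun _ : Metric.sphere (0 : Space) 1 => (1 : ℂ))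
      (fun r : Set.Ioi (0 : ℝ) => (r.1 : ℂ) ^ d * (Real.exp (-r.1 ^ 2) : ℝ)), h0, mul_zero]
  exact hpos.ne' (by exact_mod_cast h1)

/-- A homogeneous polynomial with vanishing Gaussian integral integrates to zero over spheres. -/
theorem integral_sphere_eq_zero_of_gaussianIntegral {P : MvPolynomial (Fin 3) ℂ} {d : ℕ}
    (hP : P.IsHomogeneous d) (h0 : gaussianIntegral P = 0) (r : ℝ) :
    ∫ ω, polyFun P (r • ω.1) ∂sphereMeasure = 0 := by
  -- By homogeneity the Gaussian integral factors into an integral over the unit sphere and a radial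
  -- one.
  have h : ∫ ω, polyFun P ω.1 ∂sphereMeasure = 0 := by
    rw [gaussianIntegral, integral_eq_integral_sphere_prod] at h0
    have hz (z : Metric.sphere (0 : Space) 1 × Set.Ioi (0 : ℝ)) :
        polyFun P (z.2.1 • z.1.1) * gaussian (z.2.1 • z.1.1) =
          polyFun P z.1.1 * ((z.2.1 : ℂ) ^ d * (Real.exp (-z.2.1 ^ 2) : ℝ)) := by
      have hr : ‖z.2.1 • z.1.1‖ = z.2.1 := by
        rw [norm_smul, norm_eq_of_mem_sphere, mul_one, Real.norm_of_nonneg (le_of_lt z.2.2)]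
      rw [polyFun_smul_of_isHomogeneous hP, gaussian, hr]
      ring
    simp_rw [hz] at h0
    rw [integral_prod_mul (fun ω : Metric.sphere (0 : Space) 1 => polyFun P ω.1)
      (fun r : Set.Ioi (0 : ℝ) => (r.1 : ℂ) ^ d * (Real.exp (-r.1 ^ 2) : ℝ))] at h0
    exact (mul_eq_zero.1 h0).resolve_right (integral_radial_gaussian_ne_zero d)
  simp_rw [polyFun_smul_of_isHomogeneous hP]
  rw [integral_const_mul, h, mul_zero]

theorem integrable_polyFun_sphere (P : MvPolynomial (Fin 3) ℂ) (r : ℝ) :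
    Integrable (fun ω : Metric.sphere (0 : Space) 1 => polyFun P (r • ω.1)) sphereMeasure :=
  ((continuous_polyFun P).comp (continuous_subtype_val.const_smul r)).integrable_of_hasCompactSupport
    (HasCompactSupport.of_compactSpace _)

/-! ### Separated states in Cartesian coordinates -/

theorem norm_sq_space (x : Space) : ‖x‖ ^ 2 = x 0 ^ 2 + x 1 ^ 2 + x 2 ^ 2 := by
  rw [EuclideanSpace.norm_sq_eq, Fin.sum_univ_three]
  simp

theorem norm_mul_sin_polarAngle {x : Space} (hx : x ≠ 0) :
    ‖x‖ * Real.sin (polarAngle x) = ‖(⟨x 0, x 1⟩ : ℂ)‖ := by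
  have hr : 0 < ‖x‖ := norm_pos_iff.2 hx
  have hs := norm_sq_space x
  rw [polarAngle, Real.sin_arccos, Complex.norm_def]
  nth_rewrite 1 [← Real.sqrt_sq hr.le]
  rw [← Real.sqrt_mul (sq_nonneg _)]
  congr 1
  rw [Complex.normSq_mk]
  field_simp
  linarith

theorem norm_mul_cos_polarAngle {x : Space} (hx : x ≠ 0) :
    ‖x‖ * Real.cos (polarAngle x) = x 2 := by
  have hr : 0 < ‖x‖ := norm_pos_iff.2 hx
  have h := abs_le.1 (PiLp.norm_apply_le x 2)
  rw [polarAngle, Real.cos_arccos]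
  · field_simp
  · rw [le_div_iff₀ hr]; linarith
  · rw [div_le_one hr]; exact h.2

theorem polyFun_azimuthalForm_pow {x : Space} (m : ℤ) :
    polyFun (azimuthalForm m ^ m.natAbs) x =
      (‖(⟨x 0, x 1⟩ : ℂ)‖ : ℂ) ^ m.natAbs * Complex.exp (Complex.I * m * azimuth x) := by
  have hw : (‖(⟨x 0, x 1⟩ : ℂ)‖ : ℂ) * Complex.exp (azimuth x * Complex.I) =
      x 0 + Complex.I * x 1 := by
    rw [azimuth, Complex.norm_mul_exp_arg_mul_I]
    apply Complex.ext <;> simp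
  have hv : polyFun (azimuthalForm m ^ m.natAbs) x =
      (x 0 + (if 0 ≤ m then Complex.I else -Complex.I) * x 1) ^ m.natAbs := by
    simp [polyFun, azimuthalForm]
  rw [hv]
  have hc : ((m.natAbs : ℤ) : ℂ) = (m.natAbs : ℂ) := by simp
  split_ifs with h
  · rw [← hw, mul_pow, ← Complex.exp_nat_mul, ← hc, Int.natAbs_of_nonneg h]
    congr 2; ring
  · have hw' : (‖(⟨x 0, x 1⟩ : ℂ)‖ : ℂ) * Complex.exp (-(azimuth x * Complex.I)) =
        x 0 + -Complex.I * x 1 := by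
      have := congrArg (starRingEnd ℂ) hw
      simpa [← Complex.exp_conj] using this
    rw [← hw', mul_pow, ← Complex.exp_nat_mul, ← hc, Int.ofNat_natAbs_of_nonpos (by omega)]
    congr 2; push_cast; ring

theorem eval_iterate_derivative_legendre (l M : ℕ) (t : ℝ) :
    (Polynomial.derivative^[l + M] ((Polynomial.X ^ 2 - 1 : Polynomial ℝ) ^ l)).eval t =
      ∑ j ∈ Finset.range (l + 1), (legendreCoeff l M j : ℝ) * t ^ (l - M - 2 * j) := by
  rw [sub_eq_neg_add, add_pow, Polynomial.iterate_derivative_sum, Polynomial.eval_finsetSum]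
  refine Finset.sum_congr rfl fun j _ => ?_
  have : ((-1 : Polynomial ℝ) ^ j * (Polynomial.X ^ 2) ^ (l - j) * (l.choose j : Polynomial ℝ)) =
      Polynomial.C ((-1) ^ j * (l.choose j : ℝ)) * Polynomial.X ^ (2 * (l - j)) := by
    simp [pow_mul]; ring
  rw [this, Polynomial.iterate_derivative_C_mul, Polynomial.iterate_derivative_X_pow_eq_C_mul,
    show 2 * (l - j) - (l + M) = l - M - 2 * j by omega]
  simp [legendreCoeff]
  ring

/-- Multiplication by r^l homogenizes F_l^m e^{imφ}: spread over each term, it turns r sin θ e^{±iφ}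
into x₁ ± ix₂ and r cos θ into x₃. The branch cut of the azimuth thereby disappears. -/
theorem separatedState_eq (l : ℕ) (m : ℤ) (R : ℝ → ℂ) {x : Space}
    (hx : x ≠ 0) :
    separatedState R l m x = R ‖x‖ * ((‖x‖ : ℂ) ^ l)⁻¹ * polyFun (solidHarmonic l m) x := by
  have hr : (‖x‖ : ℂ) ≠ 0 := by exact_mod_cast norm_ne_zero_iff.2 hx
  have hs : polyFun normSqPoly x = (‖x‖ : ℂ) ^ 2 := by
    simp only [polyFun, normSqPoly, Fin.sum_univ_three, map_add, map_pow, eval_X]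
    exact_mod_cast (norm_sq_space x).symm
  have hH : polyFun (solidHarmonic l m) x = (‖x‖ : ℂ) ^ l *
      (polarFactor l m (polarAngle x) : ℂ) * Complex.exp (Complex.I * m * azimuth x) := by
    have hsum : polyFun (solidHarmonic l m) x = ∑ j ∈ Finset.range (l + 1),
        (legendreCoeff l m.natAbs j : ℂ) * (polyFun normSqPoly x ^ j *
          (polyFun (azimuthalForm m ^ m.natAbs) x * (x 2 : ℂ) ^ (l - m.natAbs - 2 * j))) := by
      simp [polyFun, solidHarmonic]
    rw [hsum, polarFactor, eval_iterate_derivative_legendre, polyFun_azimuthalForm_pow, hs,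
      ← norm_mul_sin_polarAngle hx, ← norm_mul_cos_polarAngle hx]
    push_cast
    rw [Finset.mul_sum, Finset.mul_sum, Finset.sum_mul]
    refine Finset.sum_congr rfl fun j _ => ?_
    rcases lt_or_ge l (m.natAbs + 2 * j) with h | h
    · simp [legendreCoeff_eq_zero h]
    · have hp : (‖x‖ : ℂ) ^ l =
          (‖x‖ : ℂ) ^ (2 * j) * ((‖x‖ : ℂ) ^ m.natAbs * (‖x‖ : ℂ) ^ (l - m.natAbs - 2 * j)) := by
        rw [← pow_add, ← pow_add]; congr 1; omega
      rw [hp, mul_pow, mul_pow, pow_mul]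
      ring
  rw [hH, separatedState]
  field_simp

/-- Conjugation is absorbed into the radial function and the sign of m, so the cross-current becomes
bilinear in two solid harmonics. -/
theorem conj_separatedState (R : ℝ → ℂ) (l : ℕ) (m : ℤ) (x : Space) :
    starRingEnd ℂ (separatedState R l m x) =
      separatedState (fun r => starRingEnd ℂ (R r)) l (-m) x := by
  have hp : polarFactor l (-m) = polarFactor l m := by
    funext θ
    simp only [polarFactor, Int.natAbs_neg]
  simp only [separatedState, hp, map_mul, Complex.conj_ofReal, ← Complex.exp_conj, Complex.conj_I,
    map_intCast, Int.cast_neg, neg_mul, mul_neg]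

theorem hasFDerivAt_norm_space {x : Space} (hx : x ≠ 0) :
    HasFDerivAt (fun y : Space => ‖y‖) (‖x‖⁻¹ • innerSL ℝ x) x := by
  have hr : ‖x‖ ≠ 0 := norm_ne_zero_iff.2 hx
  have h := (hasStrictFDerivAt_norm_sq x).hasFDerivAt.sqrt (pow_ne_zero 2 hr)
  simp only [Real.sqrt_sq (norm_nonneg _)] at h
  refine h.congr_fderiv ?_
  ext v
  simp
  field_simp

theorem partialDeriv_radial_mul {g : ℝ → ℂ} {x : Space} (hx : x ≠ 0)
    (hg : DifferentiableAt ℝ g ‖x‖) (H : MvPolynomial (Fin 3) ℂ) (p : Fin 3) :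
    partialDeriv p (fun y => g ‖y‖ * polyFun H y) x =
      deriv g ‖x‖ / ‖x‖ * polyFun (X p * H) x + g ‖x‖ * polyFun (pderiv p H) x := by
  have hc : HasFDerivAt (fun y : Space => g ‖y‖) _ x :=
    HasFDerivAt.comp x (g := g) (f := fun y : Space => ‖y‖) hg.hasDerivAt.hasFDerivAt
      (hasFDerivAt_norm_space hx)
  have h := hc.mul (differentiable_polyFun H x).hasFDerivAt
  rw [partialDeriv]
  erw [h.fderiv]
  simp [fderiv_polyFun_single, EuclideanSpace.inner_single_right, polyFun_mul, polyFun_X]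
  ring

theorem partialDeriv_separatedState (l : ℕ) (m : ℤ) {R : ℝ → ℂ}
    (hR : ContDiffOn ℝ 1 R (Set.Ioi 0)) {x : Space} (hx : x ≠ 0) (p : Fin 3) :
    partialDeriv p (separatedState R l m) x =
      deriv (fun r : ℝ => R r * ((r : ℂ) ^ l)⁻¹) ‖x‖ / ‖x‖ * polyFun (X p * solidHarmonic l m) x +
        R ‖x‖ * ((‖x‖ : ℂ) ^ l)⁻¹ * polyFun (pderiv p (solidHarmonic l m)) x := by
  have hr : 0 < ‖x‖ := norm_pos_iff.2 hx
  have hev : separatedState R l m =ᶠ[nhds x] fun y =>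
      (fun r : ℝ => R r * ((r : ℂ) ^ l)⁻¹) ‖y‖ * polyFun (solidHarmonic l m) y := by
    filter_upwards [isOpen_compl_singleton.mem_nhds hx] with y hy
    exact separatedState_eq l m R hy
  have hdR : DifferentiableAt ℝ R ‖x‖ :=
    (hR.differentiableOn one_ne_zero).differentiableAt (Ioi_mem_nhds hr)
  have hd : DifferentiableAt ℝ (fun r : ℝ => R r * ((r : ℂ) ^ l)⁻¹) ‖x‖ := by
    refine hdR.mul (DifferentiableAt.inv ?_ ?_)
    · exact Complex.ofRealCLM.differentiableAt.pow l
    · exact pow_ne_zero _ (by exact_mod_cast hr.ne')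
  rw [partialDeriv, hev.fderiv_eq]
  exact partialDeriv_radial_mul hx hd _ p

/-! ### The cross-current and its integral -/

theorem partialDeriv_conj (f : Space → ℂ) (p : Fin 3) (x : Space) :
    partialDeriv p (fun y => starRingEnd ℂ (f y)) x = starRingEnd ℂ (partialDeriv p f x) := by
  have := Complex.conjCLE.comp_fderiv (f := f) (x := x)
  have h2 := congrArg (fun L => L (EuclideanSpace.single p 1)) this
  exact h2

theorem crossCurrent_apply_eq (hbar e c : ℝ) (A : Space → Space) (ψ ψ' : Space → ℂ) (x : Space)
    (p : Fin 3) :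
    crossCurrent hbar e c A ψ ψ' x p =
      kineticMomentum hbar e c A ψ x p * starRingEnd ℂ (ψ' x) +
        starRingEnd ℂ (kineticMomentum hbar e c A ψ' x p) * ψ x := by
  simp [crossCurrent, kineticMomentum, partialDeriv_conj]

theorem integrable_crossCurrent {hbar e c : ℝ} {A : Space → Space} {ψ ψ' : Space → ℂ}
    (hψ : MemLp ψ 2 volume) (hψ' : MemLp ψ' 2 volume)
    (hk : MemLp (kineticMomentum hbar e c A ψ) 2 volume)
    (hk' : MemLp (kineticMomentum hbar e c A ψ') 2 volume) :
    Integrable (crossCurrent hbar e c A ψ ψ') := by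
  refine Integrable.of_eval_piLp fun p => ?_
  simp only [crossCurrent_apply_eq]
  exact ((hk.eval_piLp p).integrable_mul hψ'.star).add
    ((hk'.eval_piLp p).star.integrable_mul hψ)

/-- Only the linearity of A in x matters: the magnetic term becomes a combination of the x_q·HK. -/
theorem exists_uniformVectorPotential_apply (B : Space) (p : Fin 3) :
    ∃ a : Fin 3 → ℝ, ∀ x, uniformVectorPotential B x p = ∑ q, a q * x q := by
  fin_cases p
  · refine ⟨![0, -(B 2) / 2, B 1 / 2], fun x => ?_⟩
    simp [uniformVectorPotential, cross_apply, Fin.sum_univ_three]; ring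
  · refine ⟨![B 2 / 2, 0, -(B 0) / 2], fun x => ?_⟩
    simp [uniformVectorPotential, cross_apply, Fin.sum_univ_three]; ring
  · refine ⟨![-(B 1) / 2, B 0 / 2, 0], fun x => ?_⟩
    simp [uniformVectorPotential, cross_apply, Fin.sum_univ_three]; ring

/-- The angular integrals of the dipole amplitude vanish outside the selection rules. -/
theorem IsSolidHarmonic.integral_sphere_eq_zero {l l' : ℕ} {m m' : ℤ}
    {H K : MvPolynomial (Fin 3) ℂ} (hH : IsSolidHarmonic l m H) (hK : IsSolidHarmonic l' m' K)
    (h : ¬ ((l' : ℤ) = l + 1 ∨ (l' : ℤ) = l - 1) ∨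
      ¬ (m + m' = 0 ∨ m + m' = 1 ∨ m + m' = -1)) (p : Fin 3) (r : ℝ) :
    ∫ ω, polyFun (pderiv p H * K) (r • ω.1) ∂sphereMeasure = 0 ∧
    ∫ ω, polyFun (H * pderiv p K) (r • ω.1) ∂sphereMeasure = 0 ∧
    ∫ ω, polyFun (X p * (H * K)) (r • ω.1) ∂sphereMeasure = 0 := by
  have h1 : gaussianIntegral (pderiv p H * K) = 0 := by
    rcases h with h | h
    · exact hH.gaussianIntegral_pderiv_mul_of_degree hK (by omega) p
    · exact hH.gaussianIntegral_pderiv_mul_of_magnetic hK (by omega) (by omega) (by omega) p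
  have h2 : gaussianIntegral (H * pderiv p K) = 0 := by
    rw [mul_comm]
    rcases h with h | h
    · exact hK.gaussianIntegral_pderiv_mul_of_degree hH (by omega) p
    · exact hK.gaussianIntegral_pderiv_mul_of_magnetic hH (by omega) (by omega) (by omega) p
  -- Integration by parts applied to ∂_p(HK), whose two Leibniz terms are `h1` and `h2`.
  have h3 : gaussianIntegral (X p * (H * K)) = 0 := by
    have := gaussianIntegral_pderiv p (H * K)
    rw [pderiv_mul, gaussianIntegral_add, h1, h2] at this
    simpa using this.symm
  exact ⟨integral_sphere_eq_zero_of_gaussianIntegral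
      (hH.isHomogeneous.pderiv.mul hK.isHomogeneous) h1 r,
    integral_sphere_eq_zero_of_gaussianIntegral
      (hH.isHomogeneous.mul hK.isHomogeneous.pderiv) h2 r,
    integral_sphere_eq_zero_of_gaussianIntegral
      ((isHomogeneous_X _ _).mul (hH.isHomogeneous.mul hK.isHomogeneous)) h3 r⟩

theorem integral_crossCurrent_apply_eq_zero (hbar e c : ℝ) (B : Space) {R R' : ℝ → ℂ}
    {l l' : ℕ} {m m' : ℤ} (hm : m.natAbs ≤ l) (hm' : m'.natAbs ≤ l')
    (hR : ContDiffOn ℝ 1 R (Set.Ioi 0)) (hR' : ContDiffOn ℝ 1 R' (Set.Ioi 0))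
    (h : ¬ ((l' : ℤ) = l + 1 ∨ (l' : ℤ) = l - 1) ∨ ¬ (m' = m ∨ m' = m + 1 ∨ m' = m - 1))
    (p : Fin 3) :
    ∫ x, crossCurrent hbar e c (uniformVectorPotential B) (separatedState R l m)
      (separatedState R' l' m') x p = 0 := by
  obtain ⟨a, ha⟩ := exists_uniformVectorPotential_apply B p
  set S : ℝ → ℂ := fun r => starRingEnd ℂ (R' r) with hSdef
  have hS : ContDiffOn ℝ 1 S (Set.Ioi 0) := Complex.conjCLE.contDiff.comp_contDiffOn hR'
  have hn : (-m').natAbs ≤ l' := by rwa [Int.natAbs_neg]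
  set H := solidHarmonic l m with hHdef
  set K := solidHarmonic l' (-m') with hKdef
  have hZ := (isSolidHarmonic_solidHarmonic hm).integral_sphere_eq_zero
    (isSolidHarmonic_solidHarmonic hn) (h.imp_right fun h => by omega)
  rw [← hHdef, ← hKdef] at hZ
  refine integral_eq_zero_of_integral_sphere_eq_zero fun r hr => ?_
  set g : ℂ := R r * ((r : ℂ) ^ l)⁻¹ with hg
  set k : ℂ := S r * ((r : ℂ) ^ l')⁻¹ with hk
  set g₁ : ℂ := deriv (fun r : ℝ => R r * ((r : ℂ) ^ l)⁻¹) r / r with hg₁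
  set k₁ : ℂ := deriv (fun r : ℝ => S r * ((r : ℂ) ^ l')⁻¹) r / r with hk₁
  -- On the sphere of radius r the radial factors and their derivatives are constants, leaving only
  -- polynomials covered by `hZ`.
  have key (ω : Metric.sphere (0 : Space) 1) :
      crossCurrent hbar e c (uniformVectorPotential B) (separatedState R l m)
        (separatedState R' l' m') (r • ω.1) p =
      -Complex.I * hbar * (g₁ * k - k₁ * g) * polyFun (X p * (H * K)) (r • ω.1) +
      (-Complex.I * hbar * g * k * polyFun (pderiv p H * K) (r • ω.1) +
      (Complex.I * hbar * g * k * polyFun (H * pderiv p K) (r • ω.1) +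
      ∑ q, -2 * (e / c : ℝ) * g * k * a q * polyFun (X q * (H * K)) (r • ω.1))) := by
    have hnorm : ‖r • ω.1‖ = r := by
      rw [norm_smul, norm_eq_of_mem_sphere, mul_one, Real.norm_of_nonneg hr.le]
    have hx : r • ω.1 ≠ 0 := by rw [← norm_ne_zero_iff, hnorm]; exact hr.ne'
    simp only [crossCurrent, conj_separatedState]
    rw [partialDeriv_separatedState l m hR hx, partialDeriv_separatedState l' (-m') hS hx,
      separatedState_eq l m R hx, ← hSdef, separatedState_eq l' (-m') S hx, hnorm, ha]
    rw [← hHdef, ← hKdef, ← hg, ← hk, ← hg₁, ← hk₁]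
    simp only [polyFun_mul, polyFun_X, Fin.sum_univ_three]
    push_cast
    ring
  have hmul {P : MvPolynomial (Fin 3) ℂ} (b : ℂ)
      (hP : ∫ ω, polyFun P (r • ω.1) ∂sphereMeasure = 0) :
      Integrable (fun ω : Metric.sphere (0 : Space) 1 => b * polyFun P (r • ω.1)) sphereMeasure ∧
        ∫ ω, b * polyFun P (r • ω.1) ∂sphereMeasure = 0 :=
    ⟨(integrable_polyFun_sphere P r).const_mul b, by rw [integral_const_mul, hP, mul_zero]⟩
  have hadd {f₁ f₂ : Metric.sphere (0 : Space) 1 → ℂ}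
      (h₁ : Integrable f₁ sphereMeasure ∧ ∫ ω, f₁ ω ∂sphereMeasure = 0)
      (h₂ : Integrable f₂ sphereMeasure ∧ ∫ ω, f₂ ω ∂sphereMeasure = 0) :
      Integrable (fun ω => f₁ ω + f₂ ω) sphereMeasure ∧
        ∫ ω, f₁ ω + f₂ ω ∂sphereMeasure = 0 :=
    ⟨h₁.1.add h₂.1, by rw [integral_add h₁.1 h₂.1, h₁.2, h₂.2, add_zero]⟩
  simp_rw [key, Fin.sum_univ_three]
  have hX (q : Fin 3) := (hZ q r).2.2
  exact (hadd (hmul _ (hX p)) (hadd (hmul _ (hZ p r).1) (hadd (hmul _ (hZ p r).2.1)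
    (hadd (hadd (hmul _ (hX 0)) (hmul _ (hX 1))) (hmul _ (hX 2)))))).2

end DipoleRadiation

end

theorem mainTheorem8
    (hbar μ e c κ : ℝ) (hhbar : 0 < hbar) (hμ : 0 < μ) (hc : 0 < c) (hκ : κ = 0 ∨ κ = 1)
    (φ : ℝ → ℝ) (hφ : MeasureTheory.LocallyIntegrableOn φ (Set.Ioi 0))
    (B : DipoleRadiation.Space)
    (E E' : ℝ) (R R' : ℝ → ℂ) (l l' : ℕ) (m m' : ℤ) (hm : |m| ≤ l) (hm' : |m'| ≤ l')
    (hψ : DipoleRadiation.IsStationaryState hbar μ e c κ φ B E R l m)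
    (hψ' : DipoleRadiation.IsStationaryState hbar μ e c κ φ B E' R' l' m') :
    MeasureTheory.Integrable
      (DipoleRadiation.crossCurrent hbar e c (DipoleRadiation.uniformVectorPotential B)
        (DipoleRadiation.separatedState R l m) (DipoleRadiation.separatedState R' l' m')) ∧
    ((¬ ((l' : ℤ) = l + 1 ∨ (l' : ℤ) = l - 1) ∨ ¬ (m' = m ∨ m' = m + 1 ∨ m' = m - 1)) →
      DipoleRadiation.dipoleAmplitude hbar e c (DipoleRadiation.uniformVectorPotential B)
        (DipoleRadiation.separatedState R l m) (DipoleRadiation.separatedState R' l' m') = 0) := by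
  have hint := DipoleRadiation.integrable_crossCurrent hψ.memLp hψ'.memLp
    hψ.kinetic_memLp hψ'.kinetic_memLp
  refine ⟨hint, fun h => ?_⟩
  ext p
  -- A coordinate of the vector-valued integral is the integral of that coordinate, by
  -- integrability.
  have hcomm := (EuclideanSpace.proj p : EuclideanSpace ℂ (Fin 3) →L[ℂ] ℂ).integral_comp_comm hint
  rw [DipoleRadiation.dipoleAmplitude]
  refine Eq.trans hcomm.symm ?_
  exact DipoleRadiation.integral_crossCurrent_apply_eq_zero hbar e c B
    (by rw [Int.abs_eq_natAbs] at hm; omega) (by rw [Int.abs_eq_natAbs] at hm'; omega)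
    hψ.contDiffOn hψ'.contDiffOn h p
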